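/- Let $d, N \ge 0$ be integers, let $\mathcal M_d$ be the algebra of complex $d\times d$ matrices, and let $T : \mathcal M_d \to \mathcal M_d^{\otimes N}$ be a quantum channel, i.e. a completely positive, trace preserving linear map. Assume that $T$ is $\mathcal U(d)$-covariant: $T(U^*\rho\, U) = (U^*)^{\otimes N}\, T(\rho)\, U^{\otimes N}$ for all unitary $U \in \mathcal M_d$ and all $\rho \in \mathcal M_d$. Label the tensor factors of $(\mathbb C^d)^{\otimes (N+1)}$ by $0, 1, \dots, N$, and let $$C_T = \sum_{i,j=1}^d |i\rangle\langle j| \otimes T\big(|i\rangle\langle j|\big)$$ be the Choi matrix of $T$, an operator on $(\mathbb C^d)^{\otimes (N+1)}$ in which the factor $0$ is the input space. For a permutation $\sigma \in \mathfrak S_{N+1}$ of $\{0,\dots,N\}$ let $\Pi_\sigma$ be the operator with $\Pi_\sigma(v_0\otimes\cdots\otimes v_N) = v_{\sigma^{-1}(0)}\otimes\cdots\otimes v_{\sigma^{-1}(N)}$, and let $\Pi_\sigma^{\Gamma}$ be its partial transpose with respect to the factor $0$. 1. There are complex numbers $\beta_\sigma$, $\sigma\in\mathfrak S_{N+1}$,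 such that $$C_T = \sum_{\sigma\in\mathfrak S_{N+1}} \beta_\sigma\, \Pi_\sigma^{\Gamma}.$$ 2. For every $1\le i\le N$ there is a real number $p_i$ such that the marginal $T_i(\rho) = \operatorname{Tr}_{\{1,\dots,N\}\setminus\{i\}}[T(\rho)]$ satisfies $$T_i(\rho) = p_i\,\rho + (1-p_i)\frac{I}{d}$$ for every density matrix $\rho\in\mathcal M_d$ (positive semidefinite with trace $1$), in particular for every pure state $\rho$. -/

import Mathlib

open scoped ComplexOrder Matrix MatrixOrder Matrix.Norms.L2Operator CStarAlgebra

noncomputable section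

namespace Cloning

/-- The algebra `M_d^{⊗n}` of operators on `n` copies of `ℂ^d`, written in the product basis
`e_{x 0} ⊗ ⋯ ⊗ e_{x (n-1)}`, `x : Fin n → Fin d`, of `(ℂ^d)^{⊗n}`. -/
abbrev TensorMat (d n : ℕ) : Type :=
  Matrix (Fin n → Fin d) (Fin n → Fin d) ℂ

/-- The tensor power `A^{⊗n}` of a `d × d` matrix. -/
def tensorPow {d : ℕ} (n : ℕ) (A : Matrix (Fin d) (Fin d) ℂ) : TensorMat d n :=
  Matrix.of fun x y => ∏ k, A (x k) (y k)

/-- The tensor product `A ⊗ B` on `1 + n` copies of `ℂ^d`; the factor of `A` is labelled `0` and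
the factors of `B` are labelled `1, …, n`. -/
def tensorCons {d n : ℕ} (A : Matrix (Fin d) (Fin d) ℂ) (B : TensorMat d n) :
    TensorMat d (n + 1) :=
  Matrix.of fun x y => A (x 0) (y 0) * B (Fin.tail x) (Fin.tail y)

/-- The permutation operator
`Π_σ (v_0 ⊗ ⋯ ⊗ v_{n-1}) = v_{σ⁻¹ 0} ⊗ ⋯ ⊗ v_{σ⁻¹ (n-1)}` on `(ℂ^d)^{⊗n}`. -/
def permOp (d : ℕ) {n : ℕ} (σ : Equiv.Perm (Fin n)) : TensorMat d n :=
  Matrix.of fun x y => if x = y ∘ ⇑σ⁻¹ then 1 else 0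

/-- The partial transpose with respect to the `k`-th tensor factor: the `k`-th row index and
the `k`-th column index are exchanged. -/
def partialTranspose {d n : ℕ} (k : Fin n) (M : TensorMat d n) : TensorMat d n :=
  Matrix.of fun x y => M (Function.update x k (y k)) (Function.update y k (x k))

/-- The partial trace of `M` over all tensor factors except the `i`-th one. An index
`Fin n → Fin d` is split into its value at `i` and its restriction `r` to the other factors. -/
def partialTraceExcept {d n : ℕ} (i : Fin n) (M : TensorMat d n) : Matrix (Fin d) (Fin d) ℂ :=
  Matrix.of fun a b => ∑ r : {j : Fin n // j ≠ i} → Fin d,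
    M ((Equiv.funSplitAt i (Fin d)).symm (a, r)) ((Equiv.funSplitAt i (Fin d)).symm (b, r))

/-- Density matrices: positive semidefinite matrices of trace one. -/
structure IsDensityMatrix {d : ℕ} (ρ : Matrix (Fin d) (Fin d) ℂ) : Prop where
  posSemidef : ρ.PosSemidef
  trace_eq_one : ρ.trace = 1

/-- A quantum channel `M_d → M_d^{⊗N}`: a completely positive, trace preserving linear map.
Complete positivity is Mathlib's, for the Loewner order and the operator norm on matrices. -/
structure CloningChannel (d N : ℕ) extends Matrix (Fin d) (Fin d) ℂ →CP TensorMat d N where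
  trace_map : ∀ X : Matrix (Fin d) (Fin d) ℂ, (toFun X).trace = X.trace

namespace CloningChannel

variable {d N : ℕ}

/-- `U(d)`-covariance. -/
def IsCovariant (T : CloningChannel d N) : Prop :=
  ∀ U ∈ Matrix.unitaryGroup (Fin d) ℂ, ∀ ρ : Matrix (Fin d) (Fin d) ℂ,
    T.toLinearMap (Uᴴ * ρ * U) = tensorPow N Uᴴ * T.toLinearMap ρ * tensorPow N U

/-- The Choi matrix `∑ i j, |i⟩⟨j| ⊗ T(|i⟩⟨j|)` on the copies `0, 1, …, N` of `ℂ^d`. -/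
def choi (T : CloningChannel d N) : TensorMat d (N + 1) :=
  ∑ i : Fin d, ∑ j : Fin d,
    tensorCons (Matrix.single i j 1) (T.toLinearMap (Matrix.single i j 1))

/-- The `i`-th marginal: all output copies except the `i`-th one are traced out. -/
def marginal (T : CloningChannel d N) (i : Fin N) (ρ : Matrix (Fin d) (Fin d) ℂ) :
    Matrix (Fin d) (Fin d) ℂ :=
  partialTraceExcept i (T.toLinearMap ρ)

end CloningChannel

end Cloning

end

/-! Covariance says exactly that the Choi matrix, partially transposed in factor 0, commutes with
every `U^{⊗(N+1)}`. By Schur–Weyl duality (`schur_weyl`) it is a combination of permutation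
operators, and transposing back gives part 1.

Schur–Weyl is proved in two halves. Unitaries are Zariski dense, so the commutator with a generic
`A^{⊗n}` vanishes as a polynomial in the entries of `A`; its coefficients yield commutation with the
whole commutant of the permutations. Jacobson density over the group algebra then gives the double
commutant.

For part 2 a marginal is a covariant map with one output, so only the two elements of `S_2`
contribute: it is `a tr(X) 1 + b X`. Trace preservation fixes `b = 1 - a d`, and positivity makes
`a` real. -/

namespace Cloning

open Matrix

/-! ### Tensor powers of matrices -/

section ProductMatrices

variable {ι : Type*} [Fintype ι] {d : ℕ}

theorem sum_prod_mul_prod (A B : Matrix (Fin d) (Fin d) ℂ) [DecidableEq ι] (x y : ι → Fin d) :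
    ∑ z : ι → Fin d, (∏ k, A (x k) (z k)) * ∏ k, B (z k) (y k) = ∏ k, (A * B) (x k) (y k) := by
  simp only [← Finset.prod_mul_distrib, Matrix.mul_apply, Finset.prod_univ_sum,
    Fintype.piFinset_univ]

theorem prod_one_apply (x y : ι → Fin d) :
    ∏ k, (1 : Matrix (Fin d) (Fin d) ℂ) (x k) (y k) = if x = y then 1 else 0 := by
  simp only [Matrix.one_apply, Finset.prod_ite_zero, Finset.prod_const_one, funext_iff,
    Finset.mem_univ, true_implies]

end ProductMatrices

variable {d n : ℕ}

theorem tensorPow_mul (A B : Matrix (Fin d) (Fin d) ℂ) :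
    tensorPow n (A * B) = tensorPow n A * tensorPow n B := by
  ext x y
  simp only [tensorPow, Matrix.mul_apply (M := Matrix.of _), Matrix.of_apply, sum_prod_mul_prod]

theorem tensorPow_one : tensorPow n (1 : Matrix (Fin d) (Fin d) ℂ) = 1 := by
  ext x y
  rw [Matrix.one_apply]
  exact prod_one_apply x y

theorem tensorPow_diagonal (t : Fin d → ℂ) :
    tensorPow n (diagonal t) = diagonal fun x : Fin n → Fin d => ∏ k, t (x k) := by
  ext x y
  simp only [tensorPow, Matrix.of_apply, Matrix.diagonal_apply, Finset.prod_ite_zero, funext_iff,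
    Finset.mem_univ, true_implies]

theorem infinite_unit_circle : (Metric.sphere (0 : ℂ) 1).Infinite := by
  refine (isPreconnected_sphere (by simp) 0 1).infinite_of_nontrivial
    ⟨1, by simp, -1, by simp, ?_⟩
  norm_num

theorem diagonal_mem_unitaryGroup {t : Fin d → ℂ} (ht : ∀ i, ‖t i‖ = 1) :
    diagonal t ∈ unitaryGroup (Fin d) ℂ := by
  rw [Matrix.mem_unitaryGroup_iff, star_eq_conjTranspose, diagonal_conjTranspose,
    diagonal_mul_diagonal, ← diagonal_one]
  congr 1
  ext i
  simp [Complex.mul_conj, Complex.normSq_eq_norm_sq, ht]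

/-! ### From unitaries to generic matrices -/

section Commutant

variable {M : TensorMat d n}

theorem commute_tensorPow_diagonal
    (h : ∀ U ∈ unitaryGroup (Fin d) ℂ, Commute M (tensorPow n U)) (t : Fin d → ℂ) :
    Commute M (tensorPow n (diagonal t)) := by
  rw [commute_iff_eq, tensorPow_diagonal]
  ext x y
  rw [mul_diagonal, diagonal_mul]
  -- Both sides are polynomials in `t` that agree on a product of unit circles, which are infinite
  -- sets, hence everywhere.
  have key : (MvPolynomial.C (M x y) * ∏ k, MvPolynomial.X (y k) : MvPolynomial (Fin d) ℂ) =
      (∏ k, MvPolynomial.X (x k)) * MvPolynomial.C (M x y) := by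
    refine MvPolynomial.funext_set (fun _ => Metric.sphere (0 : ℂ) 1)
      (fun _ => infinite_unit_circle) fun s hs => ?_
    have := h _ (diagonal_mem_unitaryGroup (t := s) fun i => by simpa using hs i trivial)
    rw [commute_iff_eq, tensorPow_diagonal] at this
    have := congrFun₂ this x y
    rw [mul_diagonal, diagonal_mul] at this
    simpa using this
  simpa using congrArg (MvPolynomial.eval t) key

theorem commute_tensorPow_of_isHermitian
    (h : ∀ U ∈ unitaryGroup (Fin d) ℂ, Commute M (tensorPow n U))
    {H : Matrix (Fin d) (Fin d) ℂ} (hH : H.IsHermitian) : Commute M (tensorPow n H) := by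
  rw [hH.spectral_theorem, Unitary.conjStarAlgAut_apply, tensorPow_mul, tensorPow_mul]
  exact ((h _ hH.eigenvectorUnitary.2).mul_right (commute_tensorPow_diagonal h _)).mul_right
    (h _ (star hH.eigenvectorUnitary).2)

/-- The entry at `(x, y)` of the commutator of `M` with the tensor power of a generic matrix. -/
noncomputable def commutatorPoly (M : TensorMat d n) (x y : Fin n → Fin d) :
    MvPolynomial (Fin d × Fin d) ℂ :=
  ∑ z, MvPolynomial.C (M x z) * ∏ k, MvPolynomial.X (z k, y k) -
    ∑ z, MvPolynomial.C (M z y) * ∏ k, MvPolynomial.X (x k, z k)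

theorem aeval_commutatorPoly {R : Type*} [CommRing R] [Algebra ℂ R] (M : TensorMat d n)
    (x y : Fin n → Fin d) (f : Fin d × Fin d → R) :
    MvPolynomial.aeval f (commutatorPoly M x y) =
      ∑ z, algebraMap ℂ R (M x z) * ∏ k, f (z k, y k) -
        ∑ z, algebraMap ℂ R (M z y) * ∏ k, f (x k, z k) := by
  simp [commutatorPoly]

theorem aeval_commutatorPoly_eq_zero_iff (A : Matrix (Fin d) (Fin d) ℂ) :
    (∀ x y, MvPolynomial.aeval (fun p => A p.1 p.2) (commutatorPoly M x y) = 0) ↔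
      Commute M (tensorPow n A) := by
  rw [commute_iff_eq, ← Matrix.ext_iff]
  refine forall₂_congr fun x y => ?_
  rw [aeval_commutatorPoly, sub_eq_zero]
  simp only [Matrix.mul_apply, tensorPow, Matrix.of_apply, Algebra.algebraMap_self_apply,
    mul_comm (M _ y)]

theorem commute_tensorPow
    (h : ∀ U ∈ unitaryGroup (Fin d) ℂ, Commute M (tensorPow n U))
    (A : Matrix (Fin d) (Fin d) ℂ) : Commute M (tensorPow n A) := by
  set H : Matrix (Fin d) (Fin d) ℂ := (realPart A : Matrix (Fin d) (Fin d) ℂ) with hH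
  set K : Matrix (Fin d) (Fin d) ℂ := (imaginaryPart A : Matrix (Fin d) (Fin d) ℂ) with hK
  have hA : H + Complex.I • K = A := realPart_add_I_smul_imaginaryPart A
  have hHh : H.IsHermitian := (realPart A).2
  have hKh : K.IsHermitian := (imaginaryPart A).2
  rw [← aeval_commutatorPoly_eq_zero_iff]
  intro x y
  -- The line `H + t K` is Hermitian for real `t` and equals `A` at `t = I`; a polynomial in `t`
  -- vanishing on the reals vanishes at `I`.
  let g : Fin d × Fin d → Polynomial ℂ := fun p =>
    Polynomial.C (H p.1 p.2) + Polynomial.C (K p.1 p.2) * Polynomial.X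
  have heval : ∀ t : ℂ, (MvPolynomial.aeval g (commutatorPoly M x y)).eval t =
      MvPolynomial.aeval (fun p => (H + t • K) p.1 p.2) (commutatorPoly M x y) := by
    intro t
    rw [aeval_commutatorPoly, aeval_commutatorPoly]
    simp [g, Polynomial.eval_finsetSum, Polynomial.eval_prod, mul_comm t]
  have hzero : MvPolynomial.aeval g (commutatorPoly M x y) = 0 := by
    refine Polynomial.eq_zero_of_infinite_isRoot _
      ((Set.infinite_range_of_injective Complex.ofReal_injective).mono ?_)
    rintro _ ⟨t, rfl⟩
    rw [Set.mem_ofPred_eq, Polynomial.IsRoot, heval]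
    refine (aeval_commutatorPoly_eq_zero_iff _).2 (commute_tensorPow_of_isHermitian h ?_) x y
    refine hHh.add ?_
    rw [Matrix.IsHermitian, conjTranspose_smul, hKh.eq]
    simp
  rw [← hA, ← heval, hzero, Polynomial.eval_zero]

theorem commutatorPoly_eq_zero
    (h : ∀ U ∈ unitaryGroup (Fin d) ℂ, Commute M (tensorPow n U)) (x y : Fin n → Fin d) :
    commutatorPoly M x y = 0 := by
  refine MvPolynomial.funext fun f => ?_
  rw [map_zero, ← MvPolynomial.coe_aeval_eq_eval]
  exact (aeval_commutatorPoly_eq_zero_iff (Matrix.of fun i j => f (i, j))).2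
    (commute_tensorPow h _) x y

end Commutant

/-- Equal multisets of values mean fibres of equal size, and bijections between the fibres glue to a
permutation. -/
theorem exists_perm_of_sum_single_eq {ι α : Type*} [Fintype ι] [DecidableEq α] {u v : ι → α}
    (h : ∑ k, Finsupp.single (u k) 1 = (∑ k, Finsupp.single (v k) 1 : α →₀ ℕ)) :
    ∃ σ : Equiv.Perm ι, v ∘ σ = u := by
  have hcard : ∀ a, Fintype.card {k // u k = a} = Fintype.card {k // v k = a} := by
    intro a
    have := DFunLike.congr_fun h a
    simp only [Finsupp.finsetSum_apply, Finsupp.single_apply, Finset.sum_boole,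
      Nat.cast_id] at this
    rw [Fintype.card_subtype, Fintype.card_subtype, this]
  exact ⟨Equiv.ofFiberEquiv fun a => Fintype.equivOfCardEq (hcard a),
    funext fun k => Equiv.ofFiberEquiv_map _ k⟩

/-- A matrix commuting with `U^{⊗n}` for all unitaries `U` commutes with every matrix whose entries
are invariant under simultaneous permutations of the tensor factors. -/
theorem commute_of_perm_invariant {M B : TensorMat d n}
    (h : ∀ U ∈ unitaryGroup (Fin d) ℂ, Commute M (tensorPow n U))
    (hB : ∀ (σ : Equiv.Perm (Fin n)) (x y : Fin n → Fin d), B (x ∘ σ) (y ∘ σ) = B x y) :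
    Commute M B := by
  classical
  let e : (Fin n → Fin d) × (Fin n → Fin d) → (Fin d × Fin d →₀ ℕ) := fun p =>
    ∑ k, Finsupp.single (p.1 k, p.2 k) 1
  have hfac : Function.FactorsThrough (fun p => B p.1 p.2) e := by
    rintro ⟨x, y⟩ ⟨x', y'⟩ hp
    obtain ⟨σ, hσ⟩ := exists_perm_of_sum_single_eq (u := fun k => (x k, y k))
      (v := fun k => (x' k, y' k)) hp
    have hx : x = x' ∘ σ := funext fun k => (congrArg Prod.fst (congrFun hσ k)).symm
    have hy : y = y' ∘ σ := funext fun k => (congrArg Prod.snd (congrFun hσ k)).symm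
    simp only [hx, hy, hB]
  let c := Function.extend e (fun p => B p.1 p.2) 0
  -- Invariance makes `B x y` depend only on the monomial `∏ X (x k, y k)`, so a linear functional
  -- can send each such monomial to the entry of `B`. It turns the zero commutator polynomial into
  -- the commutator of `M` and `B`.
  let L : MvPolynomial (Fin d × Fin d) ℂ →ₗ[ℂ] ℂ := (MvPolynomial.basisMonomials _ ℂ).constr ℂ c
  have hL : ∀ (a : ℂ) (x y : Fin n → Fin d),
      L (MvPolynomial.C a * ∏ k, MvPolynomial.X (x k, y k)) = a * B x y := by
    intro a x y
    have hprod : (∏ k, MvPolynomial.X (x k, y k) : MvPolynomial (Fin d × Fin d) ℂ) =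
        MvPolynomial.basisMonomials _ ℂ (e (x, y)) := by
      rw [MvPolynomial.coe_basisMonomials]
      simp only [e, MvPolynomial.monomial_sum_one]
      rfl
    rw [← MvPolynomial.smul_eq_C_mul, map_smul, hprod, Module.Basis.constr_basis, smul_eq_mul]
    congr 1
    exact hfac.extend_apply 0 (x, y)
  ext x y
  have := congrArg L (commutatorPoly_eq_zero h x y)
  rw [commutatorPoly, map_zero, map_sub, map_sum, map_sum, sub_eq_zero] at this
  simp only [hL] at this
  simpa only [Matrix.mul_apply, mul_comm (B x _)] using this

/-! ### Double commutant and Schur–Weyl duality -/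

/-- The permutation representation of the symmetric group on `(ℂ^d)^{⊗n}`. -/
def permRep (d n : ℕ) : Representation ℂ (Equiv.Perm (Fin n)) ((Fin n → Fin d) → ℂ) where
  toFun σ := LinearMap.funLeft ℂ ℂ fun x => x ∘ σ
  map_one' := rfl
  map_mul' _ _ := rfl

theorem permRep_eq (σ : Equiv.Perm (Fin n)) :
    permRep d n σ = Matrix.toLin' (permOp d σ) := by
  ext x y
  have : y ∘ σ = x ↔ y = x ∘ ⇑σ⁻¹ := by
    constructor
    · rintro rfl; ext k; simp
    · rintro rfl; ext k; simp
  simp [permRep, permOp, LinearMap.funLeft, Pi.single_apply, this]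

theorem permOp_mul_apply (σ : Equiv.Perm (Fin n)) (B : TensorMat d n) (x y : Fin n → Fin d) :
    (permOp d σ * B) x y = B (x ∘ σ) y := by
  have : ∀ z : Fin n → Fin d, x = z ∘ ⇑σ⁻¹ ↔ x ∘ σ = z := by
    intro z
    constructor
    · rintro rfl; ext k; simp
    · rintro rfl; ext k; simp
  simp only [Matrix.mul_apply, permOp, Matrix.of_apply, this, ite_mul, one_mul, zero_mul,
    Finset.sum_ite_eq, Finset.mem_univ, if_true]

theorem mul_permOp_apply (σ : Equiv.Perm (Fin n)) (B : TensorMat d n) (x y : Fin n → Fin d) :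
    (B * permOp d σ) x y = B x (y ∘ ⇑σ⁻¹) := by
  simp [Matrix.mul_apply, permOp]

theorem perm_invariant_of_commute {B : TensorMat d n}
    (hB : ∀ σ : Equiv.Perm (Fin n), Commute (permOp d σ) B) (σ : Equiv.Perm (Fin n))
    (x y : Fin n → Fin d) : B (x ∘ σ) (y ∘ σ) = B x y := by
  have := congrFun₂ (hB σ).eq x (y ∘ σ)
  rw [permOp_mul_apply, mul_permOp_apply] at this
  rw [this]
  congr 1
  ext k
  simp

/-- The double commutant property of the permutation operators. -/
theorem exists_sum_permOp_of_commute {M : TensorMat d n}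
    (h : ∀ B : TensorMat d n, (∀ σ, Commute (permOp d σ) B) → Commute M B) :
    ∃ β : Equiv.Perm (Fin n) → ℂ, M = ∑ σ, β σ • permOp d σ := by
  classical
  let ρ := permRep d n
  let R := MonoidAlgebra ℂ (Equiv.Perm (Fin n))
  let E := ρ.asModuleEquiv
  have hcomm : ∀ (e : Module.End R ρ.asModule) (v : ρ.asModule),
      E.symm (Matrix.toLin' M (E (e v))) = e (E.symm (Matrix.toLin' M (E v))) := by
    intro e v
    -- A module endomorphism, read as a matrix, commutes with all permutation operators, hence with
    -- `M`.
    let e' : Module.End ℂ ((Fin n → Fin d) → ℂ) :=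
      { toFun := fun w => E (e (E.symm w))
        map_add' := fun _ _ => by simp
        map_smul' := fun c w => by
          rw [Representation.asModuleEquiv_symm_map_smul, map_smul,
            Representation.asModuleEquiv_map_smul, AlgHom.commutes]
          rfl }
    have hB : Commute M (LinearMap.toMatrix' e') := by
      refine h _ fun σ => ?_
      rw [commute_iff_eq]
      apply Matrix.toLin'.injective
      rw [Matrix.toLin'_mul, Matrix.toLin'_mul, Matrix.toLin'_toMatrix', ← permRep_eq]
      refine LinearMap.ext fun w => ?_
      change ρ σ (E (e (E.symm w))) = E (e (E.symm (ρ σ w)))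
      rw [Representation.asModuleEquiv_symm_map_rho, map_smul,
        Representation.asModuleEquiv_map_smul, Representation.asAlgebraHom_of]
    have := congrArg Matrix.toLin' hB.eq
    rw [Matrix.toLin'_mul, Matrix.toLin'_mul, Matrix.toLin'_toMatrix'] at this
    have := LinearMap.congr_fun this (E v)
    simpa [e'] using congrArg E.symm this
  let f : Module.End (Module.End R ρ.asModule) ρ.asModule :=
    { toFun := fun v => E.symm (Matrix.toLin' M (E v))
      map_add' := fun _ _ => by simp only [map_add]
      map_smul' := fun e v => hcomm e v }
  -- Agreement of `r` with `M` on the finite standard basis is already equality; the coefficients of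
  -- `r` are the `β σ`.
  obtain ⟨r, hr⟩ := jacobson_density f
    (Finset.univ.image fun x : Fin n → Fin d => E.symm (Pi.single x 1))
  refine ⟨fun σ => r.coeff σ, ?_⟩
  apply Matrix.toLin'.injective
  have hsum : Matrix.toLin' (∑ σ, r.coeff σ • permOp d σ) = ρ.asAlgebraHom r := by
    rw [map_sum, Representation.asAlgebraHom_def, MonoidAlgebra.lift_apply,
      Finsupp.sum_fintype _ _ (by simp)]
    refine Finset.sum_congr rfl fun σ _ => ?_
    rw [map_smul, ← permRep_eq]
  rw [hsum]
  refine LinearMap.pi_ext' fun x => LinearMap.ext_ring ?_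
  have := congrArg E (hr _ (Finset.mem_image_of_mem _ (Finset.mem_univ x)))
  rw [Representation.asModuleEquiv_map_smul, LinearEquiv.apply_symm_apply] at this
  simpa [f] using this

/-- **Schur–Weyl duality**: the commutant of the operators `U^{⊗n}` with `U` unitary is spanned by
the permutation operators. -/
theorem schur_weyl {M : TensorMat d n}
    (h : ∀ U ∈ unitaryGroup (Fin d) ℂ, Commute M (tensorPow n U)) :
    ∃ β : Equiv.Perm (Fin n) → ℂ, M = ∑ σ, β σ • permOp d σ :=
  exists_sum_permOp_of_commute fun _ hB =>
    commute_of_perm_invariant h (perm_invariant_of_commute hB)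

/-! ### Covariant maps and their Choi matrices -/

section CovariantMaps

variable {d n : ℕ}

theorem tensorPow_succ_apply (U : Matrix (Fin d) (Fin d) ℂ) (x y : Fin (n + 1) → Fin d) :
    tensorPow (n + 1) U x y = U (x 0) (y 0) * tensorPow n U (Fin.tail x) (Fin.tail y) := by
  simp only [tensorPow, Matrix.of_apply, Fin.prod_univ_succ]
  rfl

theorem sum_fin_cons {β : Type*} [AddCommMonoid β] (f : (Fin (n + 1) → Fin d) → β) :
    ∑ x, f x = ∑ a, ∑ z, f (Fin.cons a z) := by
  rw [← (Fin.consEquiv fun _ => Fin d).sum_comp, Fintype.sum_prod_type]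
  rfl

/-- The partial transpose, with respect to the input factor, of the Choi matrix of a linear map. -/
def choiTranspose (T : Matrix (Fin d) (Fin d) ℂ →ₗ[ℂ] TensorMat d n) : TensorMat d (n + 1) :=
  Matrix.of fun x y => T (single (y 0) (x 0) 1) (Fin.tail x) (Fin.tail y)

theorem mul_single_eq_sum (U : Matrix (Fin d) (Fin d) ℂ) (i j : Fin d) :
    U * single j i 1 = ∑ a, U a j • single a i 1 := by
  ext p q
  simp [Matrix.sum_apply, Matrix.mul_apply, Matrix.single_apply, ite_and]

theorem single_mul_eq_sum (U : Matrix (Fin d) (Fin d) ℂ) (i j : Fin d) :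
    single j i 1 * U = ∑ b, U i b • single j b 1 := by
  ext p q
  simp [Matrix.sum_apply, Matrix.mul_apply, Matrix.single_apply, ite_and]

theorem commute_choiTranspose {T : Matrix (Fin d) (Fin d) ℂ →ₗ[ℂ] TensorMat d n}
    (hT : ∀ U ∈ unitaryGroup (Fin d) ℂ, ∀ ρ : Matrix (Fin d) (Fin d) ℂ,
      T (Uᴴ * ρ * U) = tensorPow n Uᴴ * T ρ * tensorPow n U)
    {U : Matrix (Fin d) (Fin d) ℂ} (hU : U ∈ unitaryGroup (Fin d) ℂ) :
    Commute (choiTranspose T) (tensorPow (n + 1) U) := by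
  -- Covariance at `ρ = U X`; for matrix units `X` its entries are those of the desired commutation.
  have key : ∀ X, T (U * X) * tensorPow n U = tensorPow n U * T (X * U) := by
    intro X
    have h1 : Uᴴ * (U * X) * U = X * U := by
      rw [← Matrix.mul_assoc, ← star_eq_conjTranspose, mem_unitaryGroup_iff'.1 hU, Matrix.one_mul]
    have h2 : tensorPow n U * tensorPow n Uᴴ = 1 := by
      rw [← tensorPow_mul, ← star_eq_conjTranspose, mem_unitaryGroup_iff.1 hU, tensorPow_one]
    rw [← h1, hT U hU, Matrix.mul_assoc (tensorPow n Uᴴ), ← Matrix.mul_assoc, h2, Matrix.one_mul]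
  rw [commute_iff_eq]
  ext x y
  have := congrFun₂ (key (single (y 0) (x 0) 1)) (Fin.tail x) (Fin.tail y)
  rw [mul_single_eq_sum, single_mul_eq_sum, map_sum, map_sum, Finset.sum_mul, Finset.mul_sum,
    Matrix.sum_apply, Matrix.sum_apply] at this
  simp only [map_smul, Matrix.mul_apply, Matrix.smul_apply, smul_eq_mul] at this
  rw [Matrix.mul_apply, Matrix.mul_apply, sum_fin_cons, sum_fin_cons]
  simp only [tensorPow_succ_apply, choiTranspose, Matrix.of_apply, Fin.cons_zero, Fin.tail_cons]
  refine (Finset.sum_congr rfl fun a _ => Finset.sum_congr rfl fun z _ => ?_).trans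
    (this.trans (Finset.sum_congr rfl fun a _ => Finset.sum_congr rfl fun z _ => ?_)) <;> ring

theorem exists_choiTranspose_eq {T : Matrix (Fin d) (Fin d) ℂ →ₗ[ℂ] TensorMat d n}
    (hT : ∀ U ∈ unitaryGroup (Fin d) ℂ, ∀ ρ : Matrix (Fin d) (Fin d) ℂ,
      T (Uᴴ * ρ * U) = tensorPow n Uᴴ * T ρ * tensorPow n U) :
    ∃ β : Equiv.Perm (Fin (n + 1)) → ℂ, choiTranspose T = ∑ σ, β σ • permOp d σ :=
  schur_weyl fun _ hU => commute_choiTranspose hT hU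

theorem partialTranspose_sum_smul {ι : Type*} [Fintype ι] (k : Fin n) (β : ι → ℂ)
    (M : ι → TensorMat d n) :
    partialTranspose k (∑ σ, β σ • M σ) = ∑ σ, β σ • partialTranspose k (M σ) := by
  ext x y
  simp [partialTranspose, Matrix.sum_apply]

theorem CloningChannel.choi_eq_partialTranspose (T : CloningChannel d n) :
    T.choi = partialTranspose 0 (choiTranspose T.toLinearMap) := by
  ext x y
  simp [CloningChannel.choi, partialTranspose, choiTranspose, tensorCons, Matrix.sum_apply,
    Matrix.single_apply, ite_and, Fin.tail_update_zero]

/-- A unitarily covariant linear map on `d × d` matrices is a combination of the identity and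
of `X ↦ tr X`. -/
theorem exists_eq_trace_add_of_covariant
    {S : Matrix (Fin d) (Fin d) ℂ →ₗ[ℂ] Matrix (Fin d) (Fin d) ℂ}
    (hS : ∀ U ∈ unitaryGroup (Fin d) ℂ, ∀ ρ : Matrix (Fin d) (Fin d) ℂ,
      S (Uᴴ * ρ * U) = Uᴴ * S ρ * U) :
    ∃ a b : ℂ, ∀ X, S X = (a * X.trace) • (1 : Matrix (Fin d) (Fin d) ℂ) + b • X := by
  let e := Equiv.funUnique (Fin 1) (Fin d)
  let R := Matrix.reindexAlgEquiv ℂ ℂ e.symm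
  have hR : ∀ A, R A = tensorPow 1 A := by
    intro A
    ext x y
    simp [R, e, tensorPow]
  obtain ⟨β, hβ⟩ := exists_choiTranspose_eq (T := R.toLinearMap ∘ₗ S) fun U hU ρ => by
    simp only [LinearMap.comp_apply, hS U hU, AlgEquiv.toLinearMap_apply, hR, tensorPow_mul]
  refine ⟨β 1, β (Equiv.swap 0 1), ?_⟩
  have hbasis : ∀ i j p q, S (single i j 1) p q =
      (if i = j ∧ p = q then β 1 else 0) + if p = i ∧ q = j then β (Equiv.swap 0 1) else 0 := by
    intro i j p q
    have h := congrFun₂ hβ ![j, p] ![i, q]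
    have hperm : (Finset.univ : Finset (Equiv.Perm (Fin 2))) = {1, Equiv.swap 0 1} := by decide
    rw [hperm, Finset.sum_pair (by decide)] at h
    simpa [choiTranspose, R, e, permOp, funext_iff, Fin.forall_fin_two, Fin.tail, eq_comm,
      and_comm] using h
  intro X
  conv_lhs => rw [matrix_eq_sum_single X]
  ext p q
  have : ∀ i j, single i j (X i j) = X i j • single i j (1 : ℂ) := by simp
  simp only [this, map_sum, map_smul, Matrix.sum_apply, Matrix.smul_apply, hbasis,
    Matrix.add_apply, Matrix.one_apply, Matrix.trace, Matrix.diag_apply, smul_eq_mul, mul_add,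
    Finset.sum_add_distrib, ite_and, mul_ite, mul_zero, Finset.sum_ite_eq, Finset.mem_univ, if_true]
  by_cases hpq : p = q <;> simp [hpq, mul_comm, Finset.mul_sum]

end CovariantMaps

/-! ### Partial traces -/

section PartialTrace

variable {d n : ℕ}

theorem partialTraceExcept_trace (i : Fin n) (M : TensorMat d n) :
    (partialTraceExcept i M).trace = M.trace := by
  simp only [Matrix.trace, Matrix.diag_apply, partialTraceExcept, Matrix.of_apply]
  rw [← (Equiv.funSplitAt i (Fin d)).symm.sum_comp, Fintype.sum_prod_type]

/-- `partialTraceExcept` as a linear map. -/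
noncomputable def partialTraceExceptLin (i : Fin n) :
    TensorMat d n →ₗ[ℂ] Matrix (Fin d) (Fin d) ℂ where
  toFun := partialTraceExcept i
  map_add' M M' := by
    ext a b
    simp [partialTraceExcept, Finset.sum_add_distrib]
  map_smul' c M := by
    ext a b
    simp [partialTraceExcept, Finset.mul_sum]

theorem tensorPow_funSplitAt (i : Fin n) (A : Matrix (Fin d) (Fin d) ℂ) (a b : Fin d)
    (r s : {j : Fin n // j ≠ i} → Fin d) :
    tensorPow n A ((Equiv.funSplitAt i (Fin d)).symm (a, r))
      ((Equiv.funSplitAt i (Fin d)).symm (b, s)) = A a b * ∏ k, A (r k) (s k) := by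
  simp only [tensorPow, Matrix.of_apply]
  rw [Fintype.prod_eq_mul_prod_subtype_ne _ i]
  congr 1
  · simp
  · refine Finset.prod_congr rfl fun k _ => ?_
    simp [k.2]

/-- On each traced factor, cyclicity of the trace brings `B` next to `A`, and they cancel. -/
theorem partialTraceExcept_conj (i : Fin n) {A B : Matrix (Fin d) (Fin d) ℂ} (hBA : B * A = 1)
    (M : TensorMat d n) :
    partialTraceExcept i (tensorPow n A * M * tensorPow n B) =
      A * partialTraceExcept i M * B := by
  ext a b
  let e := (Equiv.funSplitAt i (Fin d)).symm
  have hsum : ∀ f : (Fin n → Fin d) → ℂ, ∑ x, f x = ∑ c, ∑ s, f (e (c, s)) := fun f => by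
    rw [← e.sum_comp, Fintype.sum_prod_type]
  calc partialTraceExcept i (tensorPow n A * M * tensorPow n B) a b
      = ∑ r : {j : Fin n // j ≠ i} → Fin d, ∑ c', ∑ t, ∑ c, ∑ s, (A a c * ∏ k, A (r k) (s k)) * M (e (c, s)) (e (c', t)) *
          (B c' b * ∏ k, B (t k) (r k)) := by
        simp only [partialTraceExcept, Matrix.of_apply, Matrix.mul_apply, hsum, Finset.sum_mul,
          tensorPow_funSplitAt, e]
    _ = ∑ c', ∑ t, ∑ c, ∑ s, A a c * M (e (c, s)) (e (c', t)) * B c' b *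
          ∑ r : {j : Fin n // j ≠ i} → Fin d, (∏ k, B (t k) (r k)) * ∏ k, A (r k) (s k) := by
        rw [Finset.sum_comm]
        refine Finset.sum_congr rfl fun c' _ => ?_
        rw [Finset.sum_comm]
        refine Finset.sum_congr rfl fun t _ => ?_
        rw [Finset.sum_comm]
        refine Finset.sum_congr rfl fun c _ => ?_
        rw [Finset.sum_comm]
        refine Finset.sum_congr rfl fun s _ => ?_
        rw [Finset.mul_sum]
        exact Finset.sum_congr rfl fun r _ => by ring
    _ = ∑ c', ∑ c, ∑ t, A a c * M (e (c, t)) (e (c', t)) * B c' b := by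
        refine Finset.sum_congr rfl fun c' _ => ?_
        rw [Finset.sum_comm]
        simp only [sum_prod_mul_prod, hBA, prod_one_apply, mul_ite, mul_one, mul_zero,
          Finset.sum_ite_eq, Finset.mem_univ, if_true]
    _ = (A * partialTraceExcept i M * B) a b := by
        simp only [partialTraceExcept, Matrix.mul_apply, Matrix.of_apply, Finset.sum_mul,
          Finset.mul_sum, e]

theorem partialTraceExcept_diag_nonneg (i : Fin n) {M : TensorMat d n} (hM : M.PosSemidef)
    (a : Fin d) : 0 ≤ partialTraceExcept i M a a :=
  Finset.sum_nonneg fun _ _ => hM.diag_nonneg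

end PartialTrace

/-! ### Marginals of a covariant channel -/

namespace CloningChannel

variable {d N : ℕ}

theorem posSemidef_map (T : CloningChannel d N) {ρ : Matrix (Fin d) (Fin d) ℂ}
    (hρ : ρ.PosSemidef) : (T.toLinearMap ρ).PosSemidef := by
  rw [← Matrix.nonneg_iff_posSemidef] at hρ ⊢
  exact map_nonneg T.toCompletelyPositiveMap hρ

theorem exists_marginal_eq (T : CloningChannel d N) (hT : T.IsCovariant) (i : Fin N) :
    ∃ a b : ℂ, ∀ X, T.marginal i X =
      (a * X.trace) • (1 : Matrix (Fin d) (Fin d) ℂ) + b • X := by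
  refine exists_eq_trace_add_of_covariant (S := partialTraceExceptLin i ∘ₗ T.toLinearMap)
    fun U hU ρ => ?_
  change partialTraceExcept i (T.toLinearMap _) = Uᴴ * partialTraceExcept i (T.toLinearMap ρ) * U
  rw [hT U hU, partialTraceExcept_conj i]
  rw [← star_eq_conjTranspose, mem_unitaryGroup_iff.1 hU]

theorem exists_marginal_eq_depolarizing (T : CloningChannel d N) (hT : T.IsCovariant)
    (i : Fin N) : ∃ p : ℝ, ∀ ρ : Matrix (Fin d) (Fin d) ℂ, IsDensityMatrix ρ →
      T.marginal i ρ =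
        (p : ℂ) • ρ + ((1 - p : ℝ) : ℂ) • ((d : ℂ)⁻¹ • (1 : Matrix (Fin d) (Fin d) ℂ)) := by
  obtain ⟨a, b, hab⟩ := T.exists_marginal_eq hT i
  have htr : ∀ X : Matrix (Fin d) (Fin d) ℂ, a * X.trace * d + b * X.trace = X.trace := by
    intro X
    have h := (partialTraceExcept_trace i (T.toLinearMap X)).trans (T.trace_map X)
    change (T.marginal i X).trace = _ at h
    rw [hab, trace_add, trace_smul, trace_smul, trace_one, Fintype.card_fin] at h
    simpa using h
  rcases lt_trichotomy d 1 with hd | rfl | hd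
  · obtain rfl : d = 0 := by omega
    exact ⟨0, fun ρ _ => Subsingleton.elim _ _⟩
  -- For `d = 1` the only density matrix is `1 = I/d`, so any `p` would do.
  · refine ⟨1, fun ρ hρ => ?_⟩
    have hρ1 : ρ = 1 := by
      have := hρ.trace_eq_one
      ext p q
      fin_cases p; fin_cases q
      simpa [Matrix.trace] using this
    have h1 := htr 1
    simp only [trace_one, Fintype.card_fin, Nat.cast_one, mul_one] at h1
    rw [hab, hρ1, trace_one, Fintype.card_fin, ← add_smul]
    simp [h1]
  · have hd0 : (d : ℂ) ≠ 0 := by exact_mod_cast (by omega : d ≠ 0)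
    let k : Fin d := ⟨0, by omega⟩
    let l : Fin d := ⟨1, hd⟩
    have hkl : k ≠ l := by simp [k, l]
    have hpos : (single k k (1 : ℂ)).PosSemidef := by
      rw [← diagonal_single]
      exact PosSemidef.diagonal (by simp)
    -- At `|k⟩⟨k|` the diagonal entry `l ≠ k` of the marginal is `a` alone; nonnegativity in `ℂ`
    -- includes being real.
    have ha : 0 ≤ a := by
      have h : 0 ≤ T.marginal i (single k k 1) l l :=
        partialTraceExcept_diag_nonneg i (T.posSemidef_map hpos) l
      simpa [hab, Matrix.single_apply, hkl, trace_single_eq_same] using h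
    have ha' : a = (a.re : ℂ) := (Complex.eq_re_of_ofReal_le ha)
    have hb : b = 1 - a * d := by
      have := htr (single k k 1)
      rw [trace_single_eq_same] at this
      linear_combination this
    refine ⟨1 - a.re * d, fun ρ hρ => ?_⟩
    rw [hab, hρ.trace_eq_one, hb, add_comm, smul_smul]
    push_cast
    rw [← ha']
    congr 2
    field_simp
    ring

end CloningChannel

end Cloning

theorem mainTheorem8 (d N : ℕ) (T : Cloning.CloningChannel d N) (hT : T.IsCovariant) :
    (∃ β : Equiv.Perm (Fin (N + 1)) → ℂ,
      T.choi = ∑ σ : Equiv.Perm (Fin (N + 1)),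
        β σ • Cloning.partialTranspose 0 (Cloning.permOp d σ)) ∧
    (∀ i : Fin N, ∃ p : ℝ, ∀ ρ : Matrix (Fin d) (Fin d) ℂ, Cloning.IsDensityMatrix ρ →
      T.marginal i ρ =
        (p : ℂ) • ρ + ((1 - p : ℝ) : ℂ) • ((d : ℂ)⁻¹ • (1 : Matrix (Fin d) (Fin d) ℂ))) := by
  refine ⟨?_, fun i => T.exists_marginal_eq_depolarizing hT i⟩
  obtain ⟨β, hβ⟩ := Cloning.exists_choiTranspose_eq hT
  exact ⟨β, by rw [T.choi_eq_partialTranspose, hβ, Cloning.partialTranspose_sum_smul]⟩
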